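/- Let $\mathcal H\neq\{0\}$ be a complex Hilbert space and $(\mathcal K,[\cdot,\cdot])$ a Pontryagin space of negative index $\kappa$. Let $A$ be a bounded self-adjoint operator in $\mathcal K$ and $\Gamma:\mathcal H\to\mathcal K$ a bounded operator with adjoint $\Gamma^{+}$ (so $(\Gamma^{+}k,h)=[k,\Gamma h]$), and suppose that the function $$Q(z)=\Gamma^{+}(A-z)^{-1}\Gamma,\qquad z\in\rho(A),$$ is minimally represented, i.e. $\mathcal K$ is the closed linear span of $\{(A-z)^{-1}\Gamma h: z\in\rho(A),\ h\in\mathcal H\}$ (so $Q$ belongs to the generalized Nevanlinna class $N_\kappa(\mathcal H)$). Suppose that the limit $Q'(\infty):=\lim_{z\to\infty}zQ(z)$ in operator norm is boundedly invertible. For $w\in\rho(A)$ put $\Gamma_w:=(A-w)^{-1}\Gamma$ and, when $Q(w)$ is boundedly invertible, $\hat\Gamma_w:=-\Gamma_wQ(w)^{-1}$. A self-adjoint linear relation $\hat A$ in $\mathcal K$ with $\rho(A)\cap\rho(\hat A)\ne\emptyset$ is called a representing relation of $\hat Q:=-Q^{-1}$ if $Q(z)$ is boundedly invertible for every $z\in\rho(A)\cap\rho(\hat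 A)$ and, for all $w,z\in\rho(A)\cap\rho(\hat A)$, $$\hat Q(z)=\hat Q(w)^{*}+(z-\bar w)\hat\Gamma_w^{+}\bigl(I+(z-w)(\hat A-z)^{-1}\bigr)\hat\Gamma_w,\qquad \hat\Gamma_z=\bigl(I+(z-w)(\hat A-z)^{-1}\bigr)\hat\Gamma_w,$$ and, for every $w\in\rho(A)\cap\rho(\hat A)$, $\mathcal K$ is the closed linear span of $\{(I+(z-w)(\hat A-z)^{-1})\hat\Gamma_wh: z\in\rho(\hat A),\ h\in\mathcal H\}$. Then a representing relation $\hat A$ of $\hat Q$ exists, and for every such $\hat A$ the following holds. Let $S:=A\cap\hat A$, where $A$ is identified with its graph, let $S^{+}$ be its adjoint relation, $\mathcal R:=\{f\in\mathcal K:[f,g]=0\text{ for all }g\in D(S)\}$ and $\hat{\mathcal R}:=\{0\}\times\mathcal R$. Then each of $T=A$, $T=\hat A$ and $T=S^{+}$ is a regular extension of $S$, that is, $S\subsetneq T\subseteq S^{+}$ and the componentwise sum $T\,\hat{+}\,\hat{\mathcal R}=\{\{f+h,g+k\}:\{f,g\}\in T,\ \{h,k\}\in\hat{\mathcal R}\}$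 is a closed subspace of $\mathcal K\times\mathcal K$. -/

import Mathlib

open Filter Topology

noncomputable section

/-- A Pontryagin space of index `κ`, given on its associated Hilbert space `K` by the fundamental
symmetry `J`. The fundamental decomposition is `K₊ = ker (J - 1)`, `K₋ = ker (J + 1)`
(orthogonal, with sum `K`, since `J` is self-adjoint with `J² = 1`), `dim K₋ = κ`, and the Hilbert
space inner product is `[x₊, y₊] - [x₋, y₋]`. -/
structure PontryaginStructure (K : Type*) [NormedAddCommGroup K] [InnerProductSpace ℂ K]
    [CompleteSpace K] (κ : ℕ) where
  J : K →L[ℂ] K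
  selfAdjoint : IsSelfAdjoint J
  involutive : ∀ x, J (J x) = x
  finite_neg : FiniteDimensional ℂ (LinearMap.ker (J + 1 : K →L[ℂ] K).toLinearMap)
  finrank_neg : Module.finrank ℂ (LinearMap.ker (J + 1 : K →L[ℂ] K).toLinearMap) = κ

/-- Linear relations in `K`. The componentwise sum `T +̂ U` of two linear relations is `T ⊔ U`, and
inclusion, intersection are those of `Submodule ℂ (K × K)`. -/
abbrev LinRel (K : Type*) [AddCommGroup K] [Module ℂ K] := Submodule ℂ (K × K)

namespace PontryaginStructure

variable {K : Type*} [NormedAddCommGroup K] [InnerProductSpace ℂ K] [CompleteSpace K]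
  {H : Type*} [NormedAddCommGroup H] [InnerProductSpace ℂ H] [CompleteSpace H] {κ : ℕ}

/-- The scalar product `[x, y]`, linear in `x` and conjugate linear in `y`. -/
def form (P : PontryaginStructure K κ) (x y : K) : ℂ := inner ℂ (P.J y) x

/-- The adjoint `Γ⁺ : K → H` of a bounded operator `Γ : H → K` between a Hilbert space and a
Pontryagin space. -/
def opAdjoint (P : PontryaginStructure K κ) (Γ : H →L[ℂ] K) : K →L[ℂ] H :=
  (ContinuousLinearMap.adjoint Γ) ∘L P.J

/-- The defining property `(Γ⁺ k, h) = [k, Γ h]` of the adjoint. -/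
theorem inner_opAdjoint (P : PontryaginStructure K κ) (Γ : H →L[ℂ] K) (k : K) (h : H) :
    inner ℂ h (P.opAdjoint Γ k) = P.form k (Γ h) := by
  have hJ := (ContinuousLinearMap.isSelfAdjoint_iff_isSymmetric.mp P.selfAdjoint) (Γ h) k
  simp only [opAdjoint, form, ContinuousLinearMap.comp_apply,
    ContinuousLinearMap.adjoint_inner_right]
  exact hJ.symm

/-- The adjoint relation `T⁺ = {(k, h) : [k, g] = [h, f] for all (f, g) ∈ T}`. -/
def relAdjoint (P : PontryaginStructure K κ) (T : LinRel K) : LinRel K where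
  carrier := {p | ∀ q ∈ T, P.form p.1 q.2 = P.form p.2 q.1}
  zero_mem' := by intro q _; simp [form]
  add_mem' := by
    intro a b ha hb q hq
    have h1 := ha q hq
    have h2 := hb q hq
    simp only [form, Prod.fst_add, Prod.snd_add, inner_add_right] at *
    rw [h1, h2]
  smul_mem' := by
    intro c a ha q hq
    have h1 := ha q hq
    simp only [form, Prod.smul_fst, Prod.smul_snd, inner_smul_right] at *
    rw [h1]

/-- The orthogonal companion `K [-] M = {f : [f, g] = 0 for all g ∈ M}`. -/
def orthCompanion (P : PontryaginStructure K κ) (M : Submodule ℂ K) : Submodule ℂ K where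
  carrier := {f | ∀ g ∈ M, P.form f g = 0}
  zero_mem' := by intro q _; simp [form]
  add_mem' := by
    intro a b ha hb q hq
    have h1 := ha q hq
    have h2 := hb q hq
    simp only [form, inner_add_right] at *
    rw [h1, h2, add_zero]
  smul_mem' := by
    intro c a ha q hq
    have h1 := ha q hq
    simp only [form, inner_smul_right] at *
    rw [h1, mul_zero]

end PontryaginStructure

namespace LinRel

variable {K : Type*} [NormedAddCommGroup K] [InnerProductSpace ℂ K]

/-- A bounded operator as a linear relation. -/
def ofOp (A : K →L[ℂ] K) : LinRel K := LinearMap.graph A.toLinearMap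

/-- The domain `D(T)`. -/
def dom (T : LinRel K) : Submodule ℂ K := T.map (LinearMap.fst ℂ K K)

/-- `R` is the everywhere defined bounded operator `(T - z)⁻¹`: `(g, f) ∈ (T - z)⁻¹`, that is
`(f, g + z f) ∈ T`, holds exactly when `f = R g`. -/
def IsResolventAt (T : LinRel K) (z : ℂ) (R : K →L[ℂ] K) : Prop :=
  ∀ f g : K, (f, g + z • f) ∈ T ↔ f = R g

/-- The resolvent set `ρ(T)` of a closed linear relation `T`. -/
def rho (T : LinRel K) : Set ℂ := {z | ∃ R : K →L[ℂ] K, T.IsResolventAt z R}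

open Classical in
/-- The resolvent `(T - z)⁻¹` for `z ∈ ρ(T)` (and `0` for other `z`). -/
def res (T : LinRel K) (z : ℂ) : K →L[ℂ] K :=
  if h : ∃ R : K →L[ℂ] K, T.IsResolventAt z R then h.choose else 0

end LinRel

section Representations

variable {K : Type*} [NormedAddCommGroup K] [InnerProductSpace ℂ K] [CompleteSpace K]
  {H : Type*} [NormedAddCommGroup H] [InnerProductSpace ℂ H] [CompleteSpace H] {κ : ℕ}

/-- `Γ_z = (A - z)⁻¹ Γ`. -/
def gammaField (A : K →L[ℂ] K) (Γ : H →L[ℂ] K) (z : ℂ) : H →L[ℂ] K :=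
  (LinRel.ofOp A).res z ∘L Γ

/-- `Q(z) = Γ⁺ (A - z)⁻¹ Γ` for all `z ∈ ρ(A)`, where `A` is a bounded self-adjoint operator in
the Pontryagin space `K`, and this representation is minimal: `K` is the closed linear span of the
vectors `(A - z)⁻¹ Γ h`, `z ∈ ρ(A)`, `h ∈ H`. -/
structure IsMinimalOpRepresentation (P : PontryaginStructure K κ) (A : K →L[ℂ] K)
    (Γ : H →L[ℂ] K) (Q : ℂ → H →L[ℂ] H) : Prop where
  selfAdjoint : P.relAdjoint (LinRel.ofOp A) = LinRel.ofOp A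
  repr : ∀ z ∈ (LinRel.ofOp A).rho, Q z = P.opAdjoint Γ ∘L (LinRel.ofOp A).res z ∘L Γ
  minimal : (Submodule.span ℂ
    {x : K | ∃ z ∈ (LinRel.ofOp A).rho, ∃ h : H, x = gammaField A Γ z h}).topologicalClosure = ⊤

/-- `D` is the derivative of `Q` at infinity, `Q'(∞) = lim_{z → ∞} z Q(z)` in operator norm. -/
def HasDerivAtInfinity (Q : ℂ → H →L[ℂ] H) (D : H →L[ℂ] H) : Prop :=
  Tendsto (fun z : ℂ => z • Q z) (Bornology.cobounded ℂ) (𝓝 D)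

/-- `Γ̂_w = -Γ_w Q(w)⁻¹`. -/
def invGammaField (A : K →L[ℂ] K) (Γ : H →L[ℂ] K) (Q : ℂ → H →L[ℂ] H) (w : ℂ) : H →L[ℂ] K :=
  -(gammaField A Γ w ∘L Ring.inverse (Q w))

/-- `Â` is the self-adjoint linear relation representing `Q̂ = -Q⁻¹` (minimally) in the state
space `K` of `Q`, where `Q(z) = Γ⁺ (A - z)⁻¹ Γ`: every `w ∈ ρ(A) ∩ ρ(Â)` may serve as reference
point, with `Γ̂_w = -Γ_w Q(w)⁻¹`, and
`Q̂(z) = Q̂(w)* + (z - w̄) Γ̂_w⁺ (I + (z - w)(Â - z)⁻¹) Γ̂_w`,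
`Γ̂_z = (I + (z - w)(Â - z)⁻¹) Γ̂_w`. -/
structure IsInverseRepresentation (P : PontryaginStructure K κ) (A : K →L[ℂ] K)
    (Γ : H →L[ℂ] K) (Q : ℂ → H →L[ℂ] H) (Ahat : LinRel K) : Prop where
  selfAdjoint : P.relAdjoint Ahat = Ahat
  nonempty : ((LinRel.ofOp A).rho ∩ Ahat.rho).Nonempty
  /-- `Q̂ = -Q⁻¹` is defined on `ρ(A) ∩ ρ(Â)`. -/
  invertible : ∀ z ∈ (LinRel.ofOp A).rho ∩ Ahat.rho, IsUnit (Q z)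
  repr : ∀ w ∈ (LinRel.ofOp A).rho ∩ Ahat.rho, ∀ z ∈ (LinRel.ofOp A).rho ∩ Ahat.rho,
    -Ring.inverse (Q z) = ContinuousLinearMap.adjoint (-Ring.inverse (Q w)) +
      (z - starRingEnd ℂ w) • (P.opAdjoint (invGammaField A Γ Q w) ∘L
        (1 + (z - w) • Ahat.res z) ∘L invGammaField A Γ Q w)
  field : ∀ w ∈ (LinRel.ofOp A).rho ∩ Ahat.rho, ∀ z ∈ (LinRel.ofOp A).rho ∩ Ahat.rho,
    invGammaField A Γ Q z = (1 + (z - w) • Ahat.res z) ∘L invGammaField A Γ Q w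
  minimal : ∀ w ∈ (LinRel.ofOp A).rho ∩ Ahat.rho,
    (Submodule.span ℂ {x : K | ∃ z ∈ Ahat.rho, ∃ h : H,
      x = ((1 + (z - w) • Ahat.res z) ∘L invGammaField A Γ Q w) h}).topologicalClosure = ⊤

/-- The relation `𝓡̂ = {0} × 𝓡`, where `𝓡 = K [-] D(S)`. -/
def defectInfinity (P : PontryaginStructure K κ) (S : LinRel K) : LinRel K :=
  Submodule.prod ⊥ (P.orthCompanion S.dom)

/-- `T` is a proper extension of `S`: `S ⊊ T ⊆ S⁺`. -/
def IsProperExtension (P : PontryaginStructure K κ) (S T : LinRel K) : Prop :=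
  S < T ∧ T ≤ P.relAdjoint S

/-- A proper extension `T` of `S` is regular if `T +̂ 𝓡̂` is closed in `K × K`. -/
def IsRegularExtension (P : PontryaginStructure K κ) (S T : LinRel K) : Prop :=
  IsProperExtension P S T ∧ IsClosed ((T ⊔ defectInfinity P S : LinRel K) : Set (K × K))

end Representations

end

/-! Since `z (A - z)⁻¹ → -1` at infinity, `Q'(∞) = -Γ⁺Γ`. Its invertibility makes `Γ (Γ⁺Γ)⁻¹ Γ⁺` a
bounded projection onto `ran Γ` along `ker Γ⁺`, so `K` is the orthogonal sum of these two closed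
subspaces.

Hence `Â = {(f, A f + Γ h) : Γ⁺ f = 0}` is self-adjoint (`relAdjoint_inverseRel`), and Krein's
formula (`isResolventAt_inverseRel`) shows that it represents `-Q⁻¹`. The field equation fixes the
resolvent on the vectors `Γ_w h`, so it is the only representing relation (`eq_inverseRel`) once
those with `w ∈ ρ(A) ∩ ρ(Â)` are known to be total. Here the Pontryagin structure enters: `A` has
finitely many nonreal eigenvalues and no other nonreal spectrum, so the identity theorem carries
orthogonality from open sets in both half planes to all of `ρ(A)` (`inner_res_eq_zero`).

Now `S` is `A` restricted to `ker Γ⁺`, and `𝓡 = ran Γ`. The sum `A +̂ 𝓡̂` is the preimage of the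
closed space `ran Γ` under `(f, g) ↦ g - A f`, while `Â` and `S⁺` already contain `𝓡̂` and are
closed as adjoints. -/

/-! ### Punctured half planes and finite-rank perturbations of the identity. -/

/-- An open half plane with finitely many points removed is connected. -/
theorem isPreconnected_halfPlane_diff_finite {σ : ℝ} (hσ : σ ≠ 0) {F : Set ℂ} (hF : F.Finite) :
    IsPreconnected ({z : ℂ | 0 < σ * z.im} \ F) := by
  -- A continuous bijection of the plane onto the half plane, so that connectedness of the
  -- complement of a countable set in the plane applies.
  let φ : ℂ → ℂ := fun w => ⟨w.re, σ * Real.exp w.im⟩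
  have hφc : Continuous φ := by
    have : φ = fun w : ℂ => (w.re : ℂ) + ((σ * Real.exp w.im : ℝ) : ℂ) * Complex.I := by
      funext w; apply Complex.ext <;> simp [φ, -Complex.ofReal_exp]
    rw [this]; fun_prop
  have hφi : Function.Injective φ := by
    intro a b hab
    have h1 := congrArg Complex.re hab
    have h2 := congrArg Complex.im hab
    exact Complex.ext h1 (Real.exp_injective (mul_left_cancel₀ hσ h2))
  have himg : {z : ℂ | 0 < σ * z.im} \ F = φ '' (φ ⁻¹' F)ᶜ := by
    ext z
    constructor
    · rintro ⟨hz, hzF⟩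
      have hpos : 0 < z.im / σ := by
        have : z.im / σ = (σ * z.im) / σ ^ 2 := by field_simp
        rw [this]; exact div_pos hz (by positivity)
      have hw : φ ⟨z.re, Real.log (z.im / σ)⟩ = z := by
        apply Complex.ext
        · rfl
        · change σ * Real.exp (Real.log (z.im / σ)) = z.im
          rw [Real.exp_log hpos]; field_simp
      exact ⟨_, by simpa [hw] using hzF, hw⟩
    · rintro ⟨w, hw, rfl⟩
      refine ⟨?_, hw⟩
      change 0 < σ * (σ * Real.exp w.im)
      rw [← mul_assoc]; exact mul_pos (mul_self_pos.mpr hσ) (Real.exp_pos _)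
  rw [himg]
  refine IsPreconnected.image ?_ _ hφc.continuousOn
  have hcount : (φ ⁻¹' F).Countable := (hF.preimage hφi.injOn).countable
  exact (hcount.isConnected_compl_of_one_lt_rank
    (by rw [Complex.rank_real_complex]; norm_num)).isPreconnected

/-- An injective operator of the form `1 - N` with `N` of finite rank is onto. -/
theorem bijective_one_sub_of_finite_range {V : Type*} [AddCommGroup V] [Module ℂ V]
    (N : V →ₗ[ℂ] V) [FiniteDimensional ℂ (LinearMap.range N)]
    (hinj : ∀ x, N x = x → x = 0) : Function.Bijective (1 - N : V →ₗ[ℂ] V) := by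
  have hi : Function.Injective (1 - N : V →ₗ[ℂ] V) := by
    rw [injective_iff_map_eq_zero]
    intro x hx
    refine hinj x ?_
    exact (sub_eq_zero.mp hx).symm
  refine ⟨hi, fun y => ?_⟩
  have hmap : ∀ x ∈ LinearMap.range N, (1 - N : V →ₗ[ℂ] V) x ∈ LinearMap.range N := by
    intro x hx
    exact Submodule.sub_mem _ hx ⟨x, rfl⟩
  have hri : Function.Injective ((1 - N : V →ₗ[ℂ] V).restrict hmap) := by
    intro a b hab
    exact Subtype.ext (hi (congrArg Subtype.val hab))
  -- On the finite-dimensional space `ran N` injectivity gives `v` with `(1 - N) v = N y`; then `y +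
  -- v` is mapped to `y`.
  obtain ⟨v, hv⟩ := (LinearMap.injective_iff_surjective.mp hri) ⟨N y, y, rfl⟩
  have hv' : (1 - N : V →ₗ[ℂ] V) v = N y := congrArg Subtype.val hv
  refine ⟨y + v, ?_⟩
  rw [map_add, hv']
  simp

/-! ### The indefinite form and the nonreal spectrum of a self-adjoint operator. -/

namespace PontryaginStructure

variable {K : Type*} [NormedAddCommGroup K] [InnerProductSpace ℂ K] [CompleteSpace K] {κ : ℕ}

theorem inner_J_left (P : PontryaginStructure K κ) (x y : K) :
    inner ℂ (P.J x) y = inner ℂ x (P.J y) :=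
  (ContinuousLinearMap.isSelfAdjoint_iff_isSymmetric.mp P.selfAdjoint) x y

theorem form_sub_left (P : PontryaginStructure K κ) (x y z : K) :
    P.form (x - y) z = P.form x z - P.form y z := inner_sub_right _ _ _

theorem form_add_left (P : PontryaginStructure K κ) (x y z : K) :
    P.form (x + y) z = P.form x z + P.form y z := inner_add_right _ _ _

theorem form_smul_left (P : PontryaginStructure K κ) (c : ℂ) (x z : K) :
    P.form (c • x) z = c * P.form x z := inner_smul_right _ _ _

theorem form_zero_left (P : PontryaginStructure K κ) (z : K) : P.form 0 z = 0 :=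
  inner_zero_right _

theorem form_add_right (P : PontryaginStructure K κ) (x y z : K) :
    P.form x (y + z) = P.form x y + P.form x z := by
  simp only [form, map_add, inner_add_left]

theorem form_smul_right (P : PontryaginStructure K κ) (c : ℂ) (x z : K) :
    P.form x (c • z) = starRingEnd ℂ c * P.form x z := by
  simp only [form, map_smul, inner_smul_left]

theorem form_zero_right (P : PontryaginStructure K κ) (z : K) : P.form z 0 = 0 := by
  simp [form]

theorem conj_form (P : PontryaginStructure K κ) (x y : K) :
    starRingEnd ℂ (P.form x y) = P.form y x := by
  simp only [form, inner_conj_symm, inner_J_left]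

theorem eq_zero_of_form_left (P : PontryaginStructure K κ) {x : K}
    (h : ∀ y, P.form x y = 0) : x = 0 := by
  have := h (P.J x)
  rwa [form, P.involutive, inner_self_eq_zero] at this

theorem eq_of_form_left (P : PontryaginStructure K κ) {x x' : K}
    (h : ∀ y, P.form x y = P.form x' y) : x = x' := by
  rw [← sub_eq_zero]
  exact P.eq_zero_of_form_left fun y => by rw [form_sub_left, h y, sub_self]

/-- Self-adjointness of a bounded operator in terms of the indefinite form. -/
theorem form_apply_of_relAdjoint_eq (P : PontryaginStructure K κ) {A : K →L[ℂ] K}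
    (hA : P.relAdjoint (LinRel.ofOp A) = LinRel.ofOp A) (x y : K) :
    P.form (A x) y = P.form x (A y) := by
  have hx : (x, A x) ∈ P.relAdjoint (LinRel.ofOp A) := by
    rw [hA]; exact rfl
  exact (hx (y, A y) rfl).symm

/-- Gives access to Hilbert space spectral theory: `A` differs from the self-adjoint `J A` by an
operator of finite rank. -/
theorem isSelfAdjoint_J_mul (P : PontryaginStructure K κ) {A : K →L[ℂ] K}
    (hA : ∀ x y, P.form (A x) y = P.form x (A y)) : IsSelfAdjoint (P.J * A) := by
  rw [ContinuousLinearMap.isSelfAdjoint_iff_isSymmetric]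
  intro x y
  have := hA y x
  simp only [form] at this
  change inner ℂ (P.J (A x)) y = inner ℂ x (P.J (A y))
  rw [← this, inner_J_left]

/-- The nonreal spectrum of a self-adjoint operator in a Pontryagin space consists of
eigenvalues. -/
theorem mem_resolventSet_of_injective (P : PontryaginStructure K κ) {A : K →L[ℂ] K}
    (hA : ∀ x y, P.form (A x) y = P.form x (A y)) {z : ℂ} (hz : z.im ≠ 0)
    (hinj : ∀ x, A x = z • x → x = 0) : z ∈ resolventSet ℂ A := by
  set B : K →L[ℂ] K := P.J * A with hB
  have hBz : z ∈ resolventSet ℂ B := by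
    by_contra hmem
    have := (P.isSelfAdjoint_J_mul hA).mem_spectrum_eq_re (z := z) hmem
    rw [this] at hz
    simp at hz
  obtain ⟨u, hu⟩ := hBz
  let N : K →L[ℂ] K := (↑u⁻¹ : K →L[ℂ] K) * (A - B)
  have hfac : algebraMap ℂ (K →L[ℂ] K) z - A = u * (1 - N) := by
    rw [mul_sub, mul_one, Units.mul_inv_cancel_left, hu]
    abel
  -- Since `J² = 1`, `(J + 1)(A - J A) = 0`, so `A - J A` maps into the finite-dimensional `ker (J +
  -- 1)`.
  have hfin : FiniteDimensional ℂ (LinearMap.range N.toLinearMap) := by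
    have := P.finite_neg
    have hle : LinearMap.range N.toLinearMap ≤
        (LinearMap.ker (P.J + 1 : K →L[ℂ] K).toLinearMap).map
          (↑u⁻¹ : K →L[ℂ] K).toLinearMap := by
      rintro _ ⟨x, rfl⟩
      refine ⟨(A - B) x, ?_, rfl⟩
      change (P.J + 1 : K →L[ℂ] K) ((A - B) x) = 0
      simp [hB, P.involutive]
    exact Submodule.finiteDimensional_of_le hle
  have hbij : Function.Bijective (1 - N : K →L[ℂ] K) := by
    refine bijective_one_sub_of_finite_range N.toLinearMap fun x hx => hinj x ?_
    have h1 : (algebraMap ℂ (K →L[ℂ] K) z - A) x = 0 := by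
      rw [hfac]
      change (u : K →L[ℂ] K) (x - N x) = 0
      have : N x = x := hx
      rw [this, sub_self, map_zero]
    rw [sub_apply, sub_eq_zero] at h1
    rw [← h1, Algebra.algebraMap_eq_smul_one]
    rfl
  change IsUnit (algebraMap ℂ (K →L[ℂ] K) z - A)
  rw [hfac]
  exact u.isUnit.mul (ContinuousLinearMap.isUnit_iff_bijective.mpr hbij)

/-- A self-adjoint operator in a Pontryagin space has finitely many eigenvalues in a set that is
disjoint from its complex conjugate. -/
theorem finite_eigenvalues (P : PontryaginStructure K κ) {A : K →L[ℂ] K}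
    (hA : ∀ x y, P.form (A x) y = P.form x (A y)) {s : Set ℂ}
    (hs : ∀ a ∈ s, ∀ b ∈ s, a ≠ starRingEnd ℂ b) :
    {z ∈ s | ∃ x : K, x ≠ 0 ∧ A x = z • x}.Finite := by
  set E := {z ∈ s | ∃ x : K, x ≠ 0 ∧ A x = z • x}
  have hE : ∀ z : E, ∃ x : K, x ≠ 0 ∧ A x = (z : ℂ) • x := fun z => z.2.2
  choose v hv0 hv using hE
  have hli : LinearIndependent ℂ v :=
    Module.End.eigenvectors_linearIndependent A.toLinearMap E v fun z =>
      ⟨by rw [Module.End.mem_eigenspace_iff]; exact hv z, hv0 z⟩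
  -- The case `a = b` is included, so the eigenvectors span a neutral subspace.
  have horth : ∀ a b : E, P.form (v a) (v b) = 0 := by
    intro a b
    have h := hA (v a) (v b)
    rw [hv, hv, form_smul_left, form_smul_right] at h
    have hne := sub_ne_zero.mpr (hs a a.2.1 b b.2.1)
    have : ((a : ℂ) - starRingEnd ℂ (b : ℂ)) * P.form (v a) (v b) = 0 := by
      rw [sub_mul, h, sub_self]
    exact (mul_eq_zero.mp this).resolve_left hne
  have hneutral : ∀ x ∈ Submodule.span ℂ (Set.range v), P.form x x = 0 := by
    have h1 : ∀ b, ∀ x ∈ Submodule.span ℂ (Set.range v), P.form x (v b) = 0 := by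
      intro b x hx
      induction hx using Submodule.span_induction with
      | mem x hx => obtain ⟨a, rfl⟩ := hx; exact horth a b
      | zero => exact P.form_zero_left _
      | add x y _ _ hx hy => rw [form_add_left, hx, hy, add_zero]
      | smul c x _ hx => rw [form_smul_left, hx, mul_zero]
    intro x hx
    have h2 : ∀ y ∈ Submodule.span ℂ (Set.range v), P.form x y = 0 := by
      intro y hy
      induction hy using Submodule.span_induction with
      | mem y hy => obtain ⟨b, rfl⟩ := hy; exact h1 b x hx
      | zero => exact P.form_zero_right _
      | add y z _ _ hy hz => rw [form_add_right, hy, hz, add_zero]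
      | smul c y _ hy => rw [form_smul_right, hy, mul_zero]
    exact h2 x hx
  -- `1 - J` is injective on a neutral subspace: `J x = x` gives `[x, x] = ‖x‖²`. The eigenvectors
  -- thus embed independently in `ker (J + 1)`.
  let L : K →ₗ[ℂ] LinearMap.ker (P.J + 1 : K →L[ℂ] K).toLinearMap :=
    LinearMap.codRestrict _ (1 - P.J : K →L[ℂ] K).toLinearMap fun x => by
      change (P.J + 1 : K →L[ℂ] K) ((1 - P.J : K →L[ℂ] K) x) = 0
      simp [P.involutive]
  have hLli : LinearIndependent ℂ (L ∘ v) := by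
    refine hli.map ?_
    rw [Submodule.disjoint_def]
    intro x hx hLx
    have hJ : P.J x = x := by
      have : (1 - P.J : K →L[ℂ] K) x = 0 := congrArg Subtype.val (LinearMap.mem_ker.mp hLx)
      rw [sub_apply, sub_eq_zero] at this
      exact this.symm
    have := hneutral x hx
    rwa [form, hJ, inner_self_eq_zero] at this
  have := P.finite_neg
  exact Set.finite_coe_iff.mp hLli.finite

end PontryaginStructure

/-! ### Resolvents of linear relations. -/

namespace LinRel

variable {K : Type*} [NormedAddCommGroup K] [InnerProductSpace ℂ K]

theorem mem_ofOp {A : K →L[ℂ] K} {p : K × K} : p ∈ ofOp A ↔ p.2 = A p.1 := Iff.rfl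

theorem isResolventAt_res {T : LinRel K} {z : ℂ} (hz : z ∈ T.rho) :
    T.IsResolventAt z (T.res z) := by
  have h : ∃ R : K →L[ℂ] K, T.IsResolventAt z R := hz
  rw [res, dif_pos h]
  exact h.choose_spec

theorem IsResolventAt.mem {T : LinRel K} {z : ℂ} {R : K →L[ℂ] K} (h : T.IsResolventAt z R)
    (g : K) : (R g, g + z • R g) ∈ T := (h _ _).mpr rfl

theorem IsResolventAt.unique {T : LinRel K} {z : ℂ} {R R' : K →L[ℂ] K}
    (h : T.IsResolventAt z R) (h' : T.IsResolventAt z R') : R = R' := by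
  ext g
  exact (h' _ _).mp (h.mem g)

theorem IsResolventAt.res_eq {T : LinRel K} {z : ℂ} {R : K →L[ℂ] K}
    (h : T.IsResolventAt z R) : T.res z = R :=
  (isResolventAt_res ⟨R, h⟩).unique h

/-- A linear relation is determined by any of its resolvents. -/
theorem eq_of_isResolventAt {T T' : LinRel K} {z : ℂ} {R : K →L[ℂ] K}
    (h : T.IsResolventAt z R) (h' : T'.IsResolventAt z R) : T = T' := by
  ext ⟨f, g⟩
  have h1 := h f (g - z • f)
  have h2 := h' f (g - z • f)
  rw [sub_add_cancel] at h1 h2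
  rw [h1, h2]

section ofOp

variable {A : K →L[ℂ] K} {z : ℂ}

theorem apply_res (hz : z ∈ (ofOp A).rho) (g : K) :
    A ((ofOp A).res z g) = g + z • (ofOp A).res z g :=
  ((isResolventAt_res hz).mem g).symm

theorem res_apply (hz : z ∈ (ofOp A).rho) (f : K) :
    (ofOp A).res z (A f - z • f) = f := by
  symm
  rw [← isResolventAt_res hz f (A f - z • f), sub_add_cancel]
  rfl

theorem isResolventAt_neg_resolvent (hz : z ∈ resolventSet ℂ A) :
    (ofOp A).IsResolventAt z (-resolvent A z) := by
  obtain ⟨u, hu⟩ := hz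
  have hr : resolvent A z = (↑u⁻¹ : K →L[ℂ] K) := by
    rw [resolvent, ← hu, Ring.inverse_unit]
  have hu' : ∀ x, (u : K →L[ℂ] K) x = z • x - A x := by
    intro x; rw [hu, Algebra.algebraMap_eq_smul_one]; rfl
  have h1 : ∀ x, (u : K →L[ℂ] K) ((↑u⁻¹ : K →L[ℂ] K) x) = x := fun x =>
    DFunLike.congr_fun u.mul_inv x
  have h2 : ∀ x, (↑u⁻¹ : K →L[ℂ] K) ((u : K →L[ℂ] K) x) = x := fun x =>
    DFunLike.congr_fun u.inv_mul x
  intro f g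
  rw [mem_ofOp, hr]
  change g + z • f = A f ↔ f = -(↑u⁻¹ : K →L[ℂ] K) g
  constructor
  · intro h
    have : g = -(u : K →L[ℂ] K) f := by rw [hu', ← h]; abel
    rw [this, map_neg, h2, neg_neg]
  · rintro rfl
    have := hu' ((↑u⁻¹ : K →L[ℂ] K) g)
    rw [h1] at this
    rw [map_neg]
    linear_combination (norm := module) (1 : ℂ) • this

theorem rho_ofOp (A : K →L[ℂ] K) : (ofOp A).rho = resolventSet ℂ A := by
  ext z
  constructor
  · intro hz
    refine ⟨⟨algebraMap ℂ (K →L[ℂ] K) z - A, -(ofOp A).res z, ?_, ?_⟩, rfl⟩ <;> ext x <;>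
      rw [Algebra.algebraMap_eq_smul_one]
    · change z • (-(ofOp A).res z x) - A (-(ofOp A).res z x) = x
      rw [map_neg, apply_res hz]; module
    · change -(ofOp A).res z (z • x - A x) = x
      rw [← map_neg, neg_sub, res_apply hz]
  · intro hz
    exact ⟨_, isResolventAt_neg_resolvent hz⟩

theorem res_ofOp (hz : z ∈ resolventSet ℂ A) : (ofOp A).res z = -resolvent A z :=
  (isResolventAt_neg_resolvent hz).res_eq

end ofOp

variable [CompleteSpace K]

/-- For `w` near `z`, `(T - w)⁻¹ = (1 - (w - z) R)⁻¹ R` with `R = (T - z)⁻¹`. -/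
theorem isOpen_rho (T : LinRel K) : IsOpen T.rho := by
  rw [isOpen_iff_mem_nhds]
  rintro z ⟨R, hR⟩
  have hcont : Continuous fun w : ℂ => (1 - (w - z) • R : K →L[ℂ] K) := by fun_prop
  have hunit : ∀ᶠ w in 𝓝 z, IsUnit (1 - (w - z) • R : K →L[ℂ] K) :=
    hcont.continuousAt.eventually_mem (Units.isOpen.mem_nhds (by simp))
  filter_upwards [hunit] with w hw
  obtain ⟨u, hu⟩ := hw
  refine ⟨(↑u⁻¹ : K →L[ℂ] K) * R, fun f g => ?_⟩
  have h1 : ∀ x, (u : K →L[ℂ] K) ((↑u⁻¹ : K →L[ℂ] K) x) = x := fun x =>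
    DFunLike.congr_fun u.mul_inv x
  have h2 : ∀ x, (↑u⁻¹ : K →L[ℂ] K) ((u : K →L[ℂ] K) x) = x := fun x =>
    DFunLike.congr_fun u.inv_mul x
  have hu' : ∀ x, (u : K →L[ℂ] K) x = x - (w - z) • R x := fun x => by rw [hu]; rfl
  have hg : g + w • f = (g + (w - z) • f) + z • f := by module
  rw [hg, hR, map_add, map_smul]
  change f = R g + (w - z) • R f ↔ f = (↑u⁻¹ : K →L[ℂ] K) (R g)
  constructor
  · intro h
    rw [← h2 f, hu']
    congr 1
    exact sub_eq_of_eq_add h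
  · intro h
    have := hu' f
    rw [h, h1, ← h] at this
    rw [this]; abel

end LinRel

/-! ### Conjugation symmetry of `ρ(T)` and totality of the vectors `Γ_z h`. -/

namespace PontryaginStructure

variable {K : Type*} [NormedAddCommGroup K] [InnerProductSpace ℂ K] [CompleteSpace K]
  {H : Type*} [NormedAddCommGroup H] [InnerProductSpace ℂ H] {κ : ℕ}

/-- The operator `J R* J` is the adjoint of `R` for the form. As the pairs `(R u, u + z R u)`
exhaust `T`, membership in `T = T⁺` need only be tested on them. -/
theorem isResolventAt_conj (P : PontryaginStructure K κ) {T : LinRel K}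
    (hT : P.relAdjoint T = T) {z : ℂ} {R : K →L[ℂ] K} (hR : T.IsResolventAt z R) :
    T.IsResolventAt (starRingEnd ℂ z) (P.J * ContinuousLinearMap.adjoint R * P.J) := by
  intro f g
  have hadj : ∀ x y, P.form ((P.J * ContinuousLinearMap.adjoint R * P.J) x) y =
      P.form x (R y) := by
    intro x y
    simp only [form]
    change inner ℂ (P.J y) (P.J (ContinuousLinearMap.adjoint R (P.J x))) = _
    rw [inner_J_left, P.involutive, ContinuousLinearMap.adjoint_inner_right, ← inner_J_left]
  have key : (f, g + starRingEnd ℂ z • f) ∈ T ↔ ∀ u, P.form f u = P.form g (R u) := by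
    nth_rewrite 1 [← hT]
    constructor
    · intro h u
      have := h _ (hR.mem u)
      simp only [form_add_right, form_add_left, form_smul_left, form_smul_right] at this
      exact add_right_cancel this
    · rintro h ⟨p, q⟩ hpq
      have hp : p = R (q - z • p) := by rw [← hR, sub_add_cancel]; exact hpq
      have := h (q - z • p)
      rw [← hp] at this
      simp only [form_add_left, form_smul_left]
      rw [← this, sub_eq_add_neg, ← neg_smul, form_add_right, form_smul_right, map_neg]
      ring
  rw [key]
  constructor
  · intro h
    exact P.eq_of_form_left fun y => by rw [h, hadj]
  · rintro rfl u
    exact hadj _ _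

theorem conj_mem_rho (P : PontryaginStructure K κ) {T : LinRel K}
    (hT : P.relAdjoint T = T) {z : ℂ} (hz : z ∈ T.rho) : starRingEnd ℂ z ∈ T.rho :=
  ⟨_, P.isResolventAt_conj hT (LinRel.isResolventAt_res hz)⟩

/-- The resolvent `z ↦ (A - z)⁻¹`, tested against vectors, vanishes identically as soon as it
vanishes on open sets in both half planes. -/
theorem inner_res_eq_zero (P : PontryaginStructure K κ) {A : K →L[ℂ] K}
    (hA : ∀ x y, P.form (A x) y = P.form x (A y)) {U : Set ℂ} (hU : IsOpen U)
    (hUρ : U ⊆ (LinRel.ofOp A).rho) (hUp : ∃ z ∈ U, 0 < z.im) (hUm : ∃ z ∈ U, z.im < 0)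
    {x k : K} (hx : ∀ z ∈ U, inner ℂ x ((LinRel.ofOp A).res z k) = 0) {z : ℂ}
    (hz : z ∈ (LinRel.ofOp A).rho) : inner ℂ x ((LinRel.ofOp A).res z k) = 0 := by
  rw [LinRel.rho_ofOp] at hUρ hz
  let F : ℂ → ℂ := fun z => inner ℂ x (resolvent A z k)
  have hFdiff : DifferentiableOn ℂ F (resolventSet ℂ A) := by
    intro z hz
    have h1 : DifferentiableAt ℂ (resolvent A) z :=
      (spectrum.hasDerivAt_resolvent_const_left hz).differentiableAt
    have h2 : DifferentiableAt ℂ (fun w => resolvent A w k) z :=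
      h1.clm_apply (differentiableAt_const k)
    exact ((innerSL ℂ x).differentiableAt.comp z h2).differentiableWithinAt
  have hF : AnalyticOnNhd ℂ F (resolventSet ℂ A) :=
    hFdiff.analyticOnNhd (spectrum.isOpen_resolventSet A)
  have hFU : ∀ z ∈ U, F z = 0 := by
    intro z hz
    have h := hx z hz
    rw [LinRel.res_ofOp (hUρ hz)] at h
    simpa [F] using h
  -- The resolvent set meets each open half plane in that half plane minus finitely many
  -- eigenvalues, a connected set.
  have half : ∀ σ : ℝ, σ ≠ 0 → (∃ z ∈ U, 0 < σ * z.im) →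
      ∀ z ∈ resolventSet ℂ A, 0 < σ * z.im → F z = 0 := by
    rintro σ hσ ⟨z₀, hz₀, hσ₀⟩ z hz hσz
    have hfin := P.finite_eigenvalues hA (s := {z : ℂ | 0 < σ * z.im}) (by
      rintro a ha b hb rfl
      simp only [Set.mem_ofPred_eq, Complex.conj_im] at ha hb
      linarith)
    set E := {z ∈ {z : ℂ | 0 < σ * z.im} | ∃ x : K, x ≠ 0 ∧ A x = z • x}
    have hsub : {z : ℂ | 0 < σ * z.im} \ E ⊆ resolventSet ℂ A := by
      rintro w ⟨hw, hwE⟩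
      refine P.mem_resolventSet_of_injective hA ?_ fun y hy => ?_
      · intro h0
        have : 0 < σ * w.im := hw
        simp [h0] at this
      · by_contra hy0
        exact hwE ⟨hw, y, hy0, hy⟩
    have hmem : ∀ w ∈ resolventSet ℂ A, 0 < σ * w.im → w ∈ {z : ℂ | 0 < σ * z.im} \ E := by
      rintro w hw hσw
      refine ⟨hσw, ?_⟩
      rintro ⟨-, y, hy0, hy⟩
      rw [← LinRel.rho_ofOp] at hw
      have := LinRel.res_apply hw y
      rw [hy, sub_self, map_zero] at this
      exact hy0 this.symm
    refine (hF.mono hsub).eqOn_zero_of_preconnected_of_eventuallyEq_zero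
      (isPreconnected_halfPlane_diff_finite hσ hfin) (hmem z₀ (hUρ hz₀) hσ₀) ?_
      (hmem z hz hσz)
    filter_upwards [hU.mem_nhds hz₀] with w hw using hFU w hw
  have hup : ∀ w ∈ resolventSet ℂ A, 0 < w.im → F w = 0 := fun w hw hwi =>
    half 1 one_ne_zero (by simpa using hUp) w hw (by simpa using hwi)
  have hlow : ∀ w ∈ resolventSet ℂ A, w.im < 0 → F w = 0 := fun w hw hwi =>
    half (-1) (by norm_num) (by simpa using hUm) w hw (by simpa using hwi)
  have hFz : F z = 0 := by
    rcases lt_trichotomy z.im 0 with h | h | h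
    · exact hlow z hz h
    -- Real points of `ρ(A)` are limits of points of `ρ(A)` in the upper half plane.
    · let φ : ℝ → ℂ := fun t => z + t * Complex.I
      have hφ : Tendsto φ (𝓝[>] 0) (𝓝 z) := by
        have hc : Continuous φ := by fun_prop
        have := hc.tendsto 0
        simp only [φ, Complex.ofReal_zero, zero_mul, add_zero] at this
        exact this.mono_left nhdsWithin_le_nhds
      have hlim : Tendsto (fun t => F (φ t)) (𝓝[>] 0) (𝓝 (F z)) :=
        (hF z hz).continuousAt.tendsto.comp hφ
      refine tendsto_nhds_unique_of_eventuallyEq hlim tendsto_const_nhds ?_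
      filter_upwards [hφ.eventually_mem ((spectrum.isOpen_resolventSet A).mem_nhds hz),
        self_mem_nhdsWithin] with t ht ht0
      refine hup _ ht ?_
      simpa [φ, h] using ht0
    · exact hup z hz h
  rw [LinRel.res_ofOp hz]
  simpa [F] using hFz

/-- Allows minimality to be used with `ρ(A)` shrunk to an open subset on which `Q⁻¹` or another
resolvent is available. -/
theorem dense_span_gammaField (P : PontryaginStructure K κ) {A : K →L[ℂ] K} {Γ : H →L[ℂ] K}
    (hA : ∀ x y, P.form (A x) y = P.form x (A y)) {U : Set ℂ} (hU : IsOpen U)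
    (hUρ : U ⊆ (LinRel.ofOp A).rho) (hUp : ∃ z ∈ U, 0 < z.im) (hUm : ∃ z ∈ U, z.im < 0)
    (hmin : (Submodule.span ℂ {x : K | ∃ z ∈ (LinRel.ofOp A).rho, ∃ h : H,
      x = gammaField A Γ z h}).topologicalClosure = ⊤) :
    (Submodule.span ℂ {x : K | ∃ z ∈ U, ∃ h : H, x = gammaField A Γ z h}).topologicalClosure
      = ⊤ := by
  rw [Submodule.topologicalClosure_eq_top_iff, Submodule.eq_bot_iff] at hmin ⊢
  intro x hx
  refine hmin x ?_
  rw [Submodule.mem_orthogonal'] at hx ⊢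
  intro y hy
  induction hy using Submodule.span_induction with
  | mem y hy =>
    obtain ⟨z, hz, h, rfl⟩ := hy
    exact P.inner_res_eq_zero hA hU hUρ hUp hUm
      (fun w hw => hx _ (Submodule.subset_span ⟨w, hw, h, rfl⟩)) hz
  | zero => exact inner_zero_right _
  | add y y' _ _ h h' => rw [inner_add_right, h, h', add_zero]
  | smul c y _ h => rw [inner_smul_right, h, mul_zero]

end PontryaginStructure

theorem apply_ringInverse {V : Type*} [NormedAddCommGroup V] [NormedSpace ℂ V]
    {T : V →L[ℂ] V} (hT : IsUnit T) (x : V) : T (Ring.inverse T x) = x :=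
  DFunLike.congr_fun (Ring.mul_inverse_cancel T hT) x

theorem ringInverse_apply {V : Type*} [NormedAddCommGroup V] [NormedSpace ℂ V]
    {T : V →L[ℂ] V} (hT : IsUnit T) (x : V) : Ring.inverse T (T x) = x :=
  DFunLike.congr_fun (Ring.inverse_mul_cancel T hT) x

/-- A nonempty open subset of the plane that is symmetric about the real axis meets both open
half planes. -/
theorem exists_im_pos_and_im_neg {U : Set ℂ} (hU : IsOpen U) (hne : U.Nonempty)
    (hconj : ∀ z ∈ U, starRingEnd ℂ z ∈ U) :
    (∃ z ∈ U, 0 < z.im) ∧ ∃ z ∈ U, z.im < 0 := by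
  have hex : ∃ z ∈ U, z.im ≠ 0 := by
    obtain ⟨z, hz⟩ := hne
    by_cases h : z.im = 0
    · have hφ : Tendsto (fun t : ℝ => z + t * Complex.I) (𝓝[>] 0) (𝓝 z) := by
        have hc : Continuous fun t : ℝ => z + t * Complex.I := by fun_prop
        have := hc.tendsto 0
        simp only [Complex.ofReal_zero, zero_mul, add_zero] at this
        exact this.mono_left nhdsWithin_le_nhds
      obtain ⟨t, ht, ht0⟩ := ((hφ.eventually_mem (hU.mem_nhds hz)).and
        self_mem_nhdsWithin).exists
      exact ⟨_, ht, by simpa [h] using (ne_of_gt (show (0 : ℝ) < t from ht0))⟩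
    · exact ⟨z, hz, h⟩
  obtain ⟨z, hz, h⟩ := hex
  rcases lt_or_gt_of_ne h with h | h
  · exact ⟨⟨_, hconj z hz, by simpa using h⟩, z, hz, h⟩
  · exact ⟨⟨z, hz, h⟩, _, hconj z hz, by simpa using h⟩

/-! ### The splitting of `K` into `ran Γ` and `ker Γ⁺`, and the relation `Â`. -/

namespace PontryaginStructure

variable {K : Type*} [NormedAddCommGroup K] [InnerProductSpace ℂ K] [CompleteSpace K]
  {H : Type*} [NormedAddCommGroup H] [InnerProductSpace ℂ H] [CompleteSpace H] {κ : ℕ}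

theorem isClosed_relAdjoint (P : PontryaginStructure K κ) (T : LinRel K) :
    IsClosed (P.relAdjoint T : Set (K × K)) := by
  have : (P.relAdjoint T : Set (K × K)) =
      ⋂ q ∈ T, {p : K × K | P.form p.1 q.2 = P.form p.2 q.1} := by
    ext p
    simp only [Set.mem_iInter]
    rfl
  rw [this]
  refine isClosed_biInter fun q _ => ?_
  simp only [form]
  exact isClosed_eq (by fun_prop) (by fun_prop)

theorem relAdjoint_antitone (P : PontryaginStructure K κ) {S T : LinRel K} (h : S ≤ T) :
    P.relAdjoint T ≤ P.relAdjoint S := fun _ hp q hq => hp q (h hq)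

theorem form_gamma_left (P : PontryaginStructure K κ) (Γ : H →L[ℂ] K) (h : H) (k : K) :
    P.form (Γ h) k = inner ℂ (P.opAdjoint Γ k) h := by
  rw [← P.conj_form, ← P.inner_opAdjoint, inner_conj_symm]

/-- If `Γ⁺ Γ` is invertible, the orthogonal companion of `ker Γ⁺` is the range of `Γ`. -/
theorem eq_gamma_of_orthogonal (P : PontryaginStructure K κ) {Γ : H →L[ℂ] K}
    (hG : IsUnit (P.opAdjoint Γ ∘L Γ)) {x : K}
    (hx : ∀ k, P.opAdjoint Γ k = 0 → P.form x k = 0) :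
    x = Γ (Ring.inverse (P.opAdjoint Γ ∘L Γ) (P.opAdjoint Γ x)) := by
  -- The component of `v` in `ker Γ⁺` along `ran Γ`.
  have hker : ∀ v, P.opAdjoint Γ
      (v - Γ (Ring.inverse (P.opAdjoint Γ ∘L Γ) (P.opAdjoint Γ v))) = 0 := fun v => by
    have := apply_ringInverse hG (P.opAdjoint Γ v)
    rw [ContinuousLinearMap.comp_apply] at this
    rw [map_sub, this, sub_self]
  rw [← sub_eq_zero]
  refine P.eq_zero_of_form_left fun v => ?_
  set a := Ring.inverse (P.opAdjoint Γ ∘L Γ) (P.opAdjoint Γ x)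
  set b := Ring.inverse (P.opAdjoint Γ ∘L Γ) (P.opAdjoint Γ v)
  rw [show v = (v - Γ b) + Γ b by abel, form_add_right, ← P.inner_opAdjoint, hker,
    inner_zero_right, add_zero, form_sub_left, hx _ (hker v), form_gamma_left, hker,
    inner_zero_left, sub_zero]

/-- Exhibits `ran Γ` as the fixed-point set of a bounded projection, hence as closed. -/
theorem exists_eq_gamma_iff (P : PontryaginStructure K κ) {Γ : H →L[ℂ] K}
    (hG : IsUnit (P.opAdjoint Γ ∘L Γ)) {x : K} :
    (∃ h, x = Γ h) ↔ x = Γ (Ring.inverse (P.opAdjoint Γ ∘L Γ) (P.opAdjoint Γ x)) := by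
  refine ⟨?_, fun h => ⟨_, h⟩⟩
  rintro ⟨h, rfl⟩
  rw [← ContinuousLinearMap.comp_apply (P.opAdjoint Γ) Γ h, ringInverse_apply hG]

theorem gamma_injective (P : PontryaginStructure K κ) {Γ : H →L[ℂ] K}
    (hG : IsUnit (P.opAdjoint Γ ∘L Γ)) {h : H} (hh : Γ h = 0) : h = 0 := by
  rw [← ringInverse_apply hG h, ContinuousLinearMap.comp_apply, hh, map_zero, map_zero]

/-- The relation `{(f, A f + Γ h) : Γ⁺ f = 0}`, which represents `-Q⁻¹` when `Γ⁺ Γ` is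
invertible. -/
def inverseRel (P : PontryaginStructure K κ) (A : K →L[ℂ] K) (Γ : H →L[ℂ] K) : LinRel K where
  carrier := {p | P.opAdjoint Γ p.1 = 0 ∧ ∃ h, p.2 = A p.1 + Γ h}
  zero_mem' := ⟨by simp, 0, by simp⟩
  add_mem' := by
    rintro a b ⟨ha, h, hah⟩ ⟨hb, k, hbk⟩
    refine ⟨by simp [ha, hb], h + k, ?_⟩
    simp only [Prod.snd_add, Prod.fst_add, hah, hbk, map_add]
    abel
  smul_mem' := by
    rintro c a ⟨ha, h, hah⟩
    refine ⟨by simp [ha], c • h, ?_⟩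
    simp only [Prod.smul_snd, Prod.smul_fst, hah, map_smul, smul_add]

theorem mem_inverseRel (P : PontryaginStructure K κ) {A : K →L[ℂ] K} {Γ : H →L[ℂ] K}
    {p : K × K} :
    p ∈ P.inverseRel A Γ ↔ P.opAdjoint Γ p.1 = 0 ∧ ∃ h, p.2 = A p.1 + Γ h := Iff.rfl

/-- Testing `(k, g)` against `(0, Γ u)` gives `Γ⁺ k = 0`; testing against `(f, A f)` with `Γ⁺ f = 0`
makes `g - A k` orthogonal to `ker Γ⁺`, so it lies in `ran Γ`. -/
theorem relAdjoint_inverseRel (P : PontryaginStructure K κ) {A : K →L[ℂ] K} {Γ : H →L[ℂ] K}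
    (hA : ∀ x y, P.form (A x) y = P.form x (A y)) (hG : IsUnit (P.opAdjoint Γ ∘L Γ)) :
    P.relAdjoint (P.inverseRel A Γ) = P.inverseRel A Γ := by
  ext ⟨k, g⟩
  constructor
  · intro hk
    have hk0 : P.opAdjoint Γ k = 0 := by
      refine ext_inner_left ℂ fun u => ?_
      rw [P.inner_opAdjoint, inner_zero_right]
      have := hk (0, Γ u) ⟨map_zero _, u, by simp⟩
      rwa [form_zero_right] at this
    have horth : ∀ f, P.opAdjoint Γ f = 0 → P.form (g - A k) f = 0 := by
      intro f hf
      have := hk (f, A f) ⟨hf, 0, by simp⟩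
      simp only at this
      rw [form_sub_left, hA, this, sub_self]
    exact ⟨hk0, _, eq_add_of_sub_eq' (P.eq_gamma_of_orthogonal hG horth)⟩
  · rintro ⟨hk, u, hu⟩ ⟨f, g'⟩ ⟨hf, v, hv⟩
    simp only at hk hu hf hv
    simp only [hu, hv, form_add_left, form_add_right, hA, form_gamma_left, hf,
      ← P.inner_opAdjoint, hk, inner_zero_left, inner_zero_right]

/-! ### Krein's formula and the resolvent set of `Â`. -/

section Resolvent

variable {A : K →L[ℂ] K} {Γ : H →L[ℂ] K} {z : ℂ}

/-- Krein's formula for the resolvent of `inverseRel`. -/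
theorem isResolventAt_inverseRel (P : PontryaginStructure K κ) (hz : z ∈ (LinRel.ofOp A).rho)
    (hu : IsUnit (P.opAdjoint Γ ∘L (LinRel.ofOp A).res z ∘L Γ)) :
    (P.inverseRel A Γ).IsResolventAt z ((LinRel.ofOp A).res z -
      (LinRel.ofOp A).res z ∘L Γ ∘L
        Ring.inverse (P.opAdjoint Γ ∘L (LinRel.ofOp A).res z ∘L Γ) ∘L
          P.opAdjoint Γ ∘L (LinRel.ofOp A).res z) := by
  set R := (LinRel.ofOp A).res z
  set q := P.opAdjoint Γ ∘L R ∘L Γ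
  have hqa : ∀ h, q h = P.opAdjoint Γ (R (Γ h)) := fun _ => rfl
  intro f g
  change _ ↔ f = R g - R (Γ (Ring.inverse q (P.opAdjoint Γ (R g))))
  rw [mem_inverseRel]
  constructor
  · rintro ⟨hf, h, hh⟩
    simp only at hf hh
    have h1 : f = R g - R (Γ h) := by
      rw [← LinRel.res_apply hz f, ← map_sub]
      congr 1
      linear_combination (norm := module) (-1 : ℂ) • hh
    -- The constraint `Γ⁺ f = 0` determines `h`.
    have h2 : P.opAdjoint Γ (R g) = q h := by
      rw [h1, map_sub, sub_eq_zero] at hf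
      exact hf
    rw [h2, ringInverse_apply hu]
    exact h1
  · intro hf
    set h := Ring.inverse q (P.opAdjoint Γ (R g)) with hh
    refine ⟨?_, h, ?_⟩
    · simp only
      rw [hf, map_sub, ← hqa, hh, apply_ringInverse hu, sub_self]
    · simp only
      rw [hf, map_sub, LinRel.apply_res hz, LinRel.apply_res hz]
      module

/-- If `Q(z) h = 0`, then `(A - z)⁻¹ Γ h` lies in `ker (Â - z) = 0`, so `Γ h = 0`. For surjectivity,
take `f₀` with `Γ⁺ f₀ = u`: applying `(Â - z)⁻¹` to `(A - z) f₀` gives `f₀ - (A - z)⁻¹ Γ h` in `ker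
Γ⁺`, that is, `Q(z) h = u`. -/
theorem isUnit_of_mem_rho_inverseRel (P : PontryaginStructure K κ)
    (hG : IsUnit (P.opAdjoint Γ ∘L Γ)) (hz : z ∈ (LinRel.ofOp A).rho)
    (hz' : z ∈ (P.inverseRel A Γ).rho) :
    IsUnit (P.opAdjoint Γ ∘L (LinRel.ofOp A).res z ∘L Γ) := by
  set R := (LinRel.ofOp A).res z with hR
  obtain ⟨R', hR'⟩ := hz'
  rw [ContinuousLinearMap.isUnit_iff_bijective]
  constructor
  · rw [injective_iff_map_eq_zero]
    intro h hh
    have hm : (R (Γ h), 0 + z • R (Γ h)) ∈ P.inverseRel A Γ := by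
      refine ⟨hh, -h, ?_⟩
      simp only
      rw [LinRel.apply_res hz, map_neg]
      abel
    rw [hR', map_zero] at hm
    have := LinRel.apply_res hz (Γ h)
    rw [← hR, hm, map_zero, smul_zero, add_zero] at this
    exact P.gamma_injective hG this.symm
  · intro u
    set f₀ := Γ (Ring.inverse (P.opAdjoint Γ ∘L Γ) u)
    have hf₀ : P.opAdjoint Γ f₀ = u := apply_ringInverse hG u
    set g := A f₀ - z • f₀
    obtain ⟨hf, h, hh⟩ := hR'.mem g
    simp only at hf hh
    refine ⟨h, ?_⟩
    change P.opAdjoint Γ (R (Γ h)) = u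
    have h1 : R' g = f₀ - R (Γ h) := by
      rw [← LinRel.res_apply hz (R' g), ← LinRel.res_apply hz f₀, ← map_sub]
      congr 1
      linear_combination (norm := module) (-1 : ℂ) • hh
    rw [h1, map_sub, hf₀, sub_eq_zero] at hf
    exact hf.symm

end Resolvent

end PontryaginStructure

section

variable {K : Type*} [NormedAddCommGroup K] [InnerProductSpace ℂ K]
  {H : Type*} [NormedAddCommGroup H] [InnerProductSpace ℂ H]
  {A : K →L[ℂ] K} {Γ : H →L[ℂ] K} {Q : ℂ → H →L[ℂ] H} {z : ℂ}

theorem apply_gammaField (hz : z ∈ (LinRel.ofOp A).rho) (h : H) :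
    A (gammaField A Γ z h) = Γ h + z • gammaField A Γ z h :=
  LinRel.apply_res hz (Γ h)

theorem invGammaField_apply (h : H) :
    invGammaField A Γ Q z h = -gammaField A Γ z (Ring.inverse (Q z) h) := rfl

theorem invGammaField_neg (hu : IsUnit (Q z)) (h : H) :
    invGammaField A Γ Q z (-Q z h) = gammaField A Γ z h := by
  rw [invGammaField_apply, map_neg, map_neg, neg_neg, ringInverse_apply hu]

end

/-! ### Behaviour at infinity; existence and uniqueness of the representing relation. -/

section

variable {K : Type*} [NormedAddCommGroup K] [InnerProductSpace ℂ K] [CompleteSpace K]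
  {H : Type*} [NormedAddCommGroup H] [InnerProductSpace ℂ H] [CompleteSpace H] {κ : ℕ}

theorem LinRel.eventually_mem_rho_ofOp (A : K →L[ℂ] K) :
    ∀ᶠ z in Bornology.cobounded ℂ, z ∈ (LinRel.ofOp A).rho := by
  rw [LinRel.rho_ofOp]
  filter_upwards [tendsto_norm_cobounded_atTop.eventually_gt_atTop (‖A‖ * ‖(1 : K →L[ℂ] K)‖)]
    with z hz using spectrum.mem_resolventSet_of_norm_lt_mul hz

/-- Follows from `z (A - z)⁻¹ = A (A - z)⁻¹ - 1` and the decay of the resolvent. -/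
theorem LinRel.tendsto_smul_res (A : K →L[ℂ] K) :
    Tendsto (fun z => z • (LinRel.ofOp A).res z) (Bornology.cobounded ℂ) (𝓝 (-1)) := by
  have h1 : Tendsto (fun z => -(A * resolvent A z) - 1) (Bornology.cobounded ℂ) (𝓝 (-1)) := by
    have h := ((spectrum.resolvent_tendsto_cobounded (𝕜 := ℂ) A).const_mul A).neg.sub_const 1
    simpa using h
  refine h1.congr' ?_
  filter_upwards [LinRel.eventually_mem_rho_ofOp A] with z hz
  have hr : resolvent A z = -(LinRel.ofOp A).res z := by
    rw [LinRel.rho_ofOp] at hz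
    rw [LinRel.res_ofOp hz, neg_neg]
  ext x
  have := LinRel.apply_res hz x
  rw [hr]
  change -(A (-(LinRel.ofOp A).res z x)) - x = z • (LinRel.ofOp A).res z x
  rw [map_neg, neg_neg, this]
  abel

namespace IsMinimalOpRepresentation

variable {P : PontryaginStructure K κ} {A : K →L[ℂ] K} {Γ : H →L[ℂ] K} {Q : ℂ → H →L[ℂ] H}

theorem form_apply (hQ : IsMinimalOpRepresentation P A Γ Q) (x y : K) :
    P.form (A x) y = P.form x (A y) :=
  P.form_apply_of_relAdjoint_eq hQ.selfAdjoint x y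

theorem tendsto_smul (hQ : IsMinimalOpRepresentation P A Γ Q) :
    HasDerivAtInfinity Q (-(P.opAdjoint Γ ∘L Γ)) := by
  have hc : Continuous fun R : K →L[ℂ] K => P.opAdjoint Γ ∘L R ∘L Γ := by fun_prop
  have h := (hc.tendsto (-1)).comp (LinRel.tendsto_smul_res A)
  have h1 : P.opAdjoint Γ ∘L (-1 : K →L[ℂ] K) ∘L Γ = -(P.opAdjoint Γ ∘L Γ) := by
    ext x; simp
  rw [h1] at h
  refine h.congr' ?_
  filter_upwards [LinRel.eventually_mem_rho_ofOp A] with z hz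
  rw [hQ.repr z hz]
  ext x
  simp

theorem isUnit_gram (hQ : IsMinimalOpRepresentation P A Γ Q) {D : H →L[ℂ] H}
    (hD : HasDerivAtInfinity Q D) (hDinv : IsUnit D) : IsUnit (P.opAdjoint Γ ∘L Γ) := by
  rw [← IsUnit.neg_iff, ← tendsto_nhds_unique hD hQ.tendsto_smul]
  exact hDinv

theorem eventually_isUnit (hQ : IsMinimalOpRepresentation P A Γ Q)
    (hG : IsUnit (P.opAdjoint Γ ∘L Γ)) : ∀ᶠ z in Bornology.cobounded ℂ, IsUnit (Q z) := by
  have h : ∀ᶠ z in Bornology.cobounded ℂ, IsUnit (z • Q z) :=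
    hQ.tendsto_smul.eventually (Units.isOpen.mem_nhds hG.neg)
  filter_upwards [h, Bornology.eventually_ne_cobounded (0 : ℂ)] with z hz hz0
  exact (isUnit_smul_iff (Units.mk0 z hz0) (Q z)).mp hz

theorem mem_rho_inverseRel_iff (hQ : IsMinimalOpRepresentation P A Γ Q)
    (hG : IsUnit (P.opAdjoint Γ ∘L Γ)) {z : ℂ} (hz : z ∈ (LinRel.ofOp A).rho) :
    z ∈ (P.inverseRel A Γ).rho ↔ IsUnit (Q z) := by
  rw [hQ.repr z hz]
  exact ⟨P.isUnit_of_mem_rho_inverseRel hG hz, fun h => ⟨_, P.isResolventAt_inverseRel hz h⟩⟩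

variable {z w : ℂ}

theorem opAdjoint_gammaField (hQ : IsMinimalOpRepresentation P A Γ Q)
    (hz : z ∈ (LinRel.ofOp A).rho) (h : H) : P.opAdjoint Γ (gammaField A Γ z h) = Q z h := by
  rw [hQ.repr z hz]; rfl

/-- The difference quotients of `Γ̂` lie in `inverseRel`. -/
theorem invGammaField_sub_mem (hQ : IsMinimalOpRepresentation P A Γ Q)
    (hz : z ∈ (LinRel.ofOp A).rho) (hw : w ∈ (LinRel.ofOp A).rho)
    (huz : IsUnit (Q z)) (huw : IsUnit (Q w)) (h : H) :
    (invGammaField A Γ Q z h - invGammaField A Γ Q w h,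
      z • invGammaField A Γ Q z h - w • invGammaField A Γ Q w h) ∈ P.inverseRel A Γ := by
  simp only [invGammaField_apply]
  refine ⟨?_, Ring.inverse (Q z) h - Ring.inverse (Q w) h, ?_⟩
  · simp only [map_sub, map_neg, hQ.opAdjoint_gammaField hz, hQ.opAdjoint_gammaField hw,
      apply_ringInverse huz, apply_ringInverse huw, sub_self]
  · simp only [map_sub, map_neg, apply_gammaField hz, apply_gammaField hw]
    module

theorem smul_res_invGammaField (hQ : IsMinimalOpRepresentation P A Γ Q)
    (hG : IsUnit (P.opAdjoint Γ ∘L Γ)) (hz : z ∈ (LinRel.ofOp A).rho)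
    (hw : w ∈ (LinRel.ofOp A).rho) (huz : IsUnit (Q z)) (huw : IsUnit (Q w)) (h : H) :
    (z - w) • (P.inverseRel A Γ).res z (invGammaField A Γ Q w h) =
      invGammaField A Γ Q z h - invGammaField A Γ Q w h := by
  have hR := LinRel.isResolventAt_res ((hQ.mem_rho_inverseRel_iff hG hz).mpr huz)
  have hm := hQ.invGammaField_sub_mem hz hw huz huw h
  rw [show z • invGammaField A Γ Q z h - w • invGammaField A Γ Q w h =
    (z - w) • invGammaField A Γ Q w h +
      z • (invGammaField A Γ Q z h - invGammaField A Γ Q w h) by module, hR, map_smul] at hm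
  exact hm.symm

theorem isInverseRepresentation_inverseRel (hQ : IsMinimalOpRepresentation P A Γ Q)
    (hG : IsUnit (P.opAdjoint Γ ∘L Γ)) :
    IsInverseRepresentation P A Γ Q (P.inverseRel A Γ) := by
  have hunit : ∀ z ∈ (LinRel.ofOp A).rho ∩ (P.inverseRel A Γ).rho, IsUnit (Q z) :=
    fun z hz => (hQ.mem_rho_inverseRel_iff hG hz.1).mp hz.2
  have hsa := P.relAdjoint_inverseRel hQ.form_apply hG
  have hne : ((LinRel.ofOp A).rho ∩ (P.inverseRel A Γ).rho).Nonempty := by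
    obtain ⟨z, hz, hu⟩ :=
      ((LinRel.eventually_mem_rho_ofOp A).and (hQ.eventually_isUnit hG)).exists
    exact ⟨z, hz, (hQ.mem_rho_inverseRel_iff hG hz).mpr hu⟩
  have hfield : ∀ w ∈ (LinRel.ofOp A).rho ∩ (P.inverseRel A Γ).rho,
      ∀ z ∈ (LinRel.ofOp A).rho ∩ (P.inverseRel A Γ).rho, invGammaField A Γ Q z =
        (1 + (z - w) • (P.inverseRel A Γ).res z) ∘L invGammaField A Γ Q w := by
    intro w hw z hz
    ext h
    change _ = invGammaField A Γ Q w h +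
      (z - w) • (P.inverseRel A Γ).res z (invGammaField A Γ Q w h)
    rw [hQ.smul_res_invGammaField hG hz.1 hw.1 (hunit z hz) (hunit w hw)]
    abel
  refine ⟨hsa, hne, hunit, fun w hw z hz => ?_, hfield, fun w hw => ?_⟩
  · rw [← hfield w hw z hz]
    ext h
    refine ext_inner_left ℂ fun u => ?_
    set a := Ring.inverse (Q z) h with ha
    set b := Ring.inverse (Q w) u with hb
    have hh : h = Q z a := (apply_ringInverse (hunit z hz) h).symm
    have hu : u = Q w b := (apply_ringInverse (hunit w hw) u).symm
    have e1 : inner ℂ u a = P.form (Γ a) (gammaField A Γ w b) := by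
      rw [P.form_gamma_left, hQ.opAdjoint_gammaField hw.1, ← hu]
    have e2 : inner ℂ b h = P.form (gammaField A Γ z a) (Γ b) := by
      rw [← P.inner_opAdjoint, hQ.opAdjoint_gammaField hz.1, ← hh]
    -- Inserting `A Γ_z a = Γ a + z Γ_z a` and its analogue at `w` into the symmetry of `A` yields
    -- `(a, u) + z [Γ_z a, Γ_w b] = (h, b) + w̄ [Γ_z a, Γ_w b]`, the required formula.
    have e3 := hQ.form_apply (gammaField A Γ z a) (gammaField A Γ w b)
    rw [apply_gammaField hz.1, apply_gammaField hw.1, P.form_add_left, P.form_add_right,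
      P.form_smul_left, P.form_smul_right, ← e1, ← e2] at e3
    have e4 : P.form (invGammaField A Γ Q z h) (invGammaField A Γ Q w u) =
        P.form (gammaField A Γ z a) (gammaField A Γ w b) := by
      simp only [invGammaField_apply, PontryaginStructure.form, map_neg, inner_neg_neg,
        ← ha, ← hb]
    simp only [add_apply, neg_apply, smul_apply, inner_add_right, inner_smul_right,
      inner_neg_right, ContinuousLinearMap.comp_apply, P.inner_opAdjoint, e4,
      ContinuousLinearMap.adjoint_inner_right, inner_neg_left, ← ha, ← hb]
    linear_combination -e3
  · obtain ⟨hp, hm⟩ := exists_im_pos_and_im_neg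
      ((LinRel.isOpen_rho _).inter (LinRel.isOpen_rho _)) hne fun z hz =>
        ⟨P.conj_mem_rho hQ.selfAdjoint hz.1, P.conj_mem_rho hsa hz.2⟩
    rw [eq_top_iff, ← P.dense_span_gammaField hQ.form_apply
      ((LinRel.isOpen_rho _).inter (LinRel.isOpen_rho _)) Set.inter_subset_left hp hm hQ.minimal]
    refine Submodule.topologicalClosure_mono (Submodule.span_mono ?_)
    rintro _ ⟨z, hz, h, rfl⟩
    exact ⟨z, hz.2, -Q z h, by rw [← hfield w hw z hz, invGammaField_neg (hunit z hz)]⟩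

/-- The representing relation of `-Q⁻¹` is unique. -/
theorem eq_inverseRel (hQ : IsMinimalOpRepresentation P A Γ Q)
    (hG : IsUnit (P.opAdjoint Γ ∘L Γ)) {T : LinRel K}
    (hT : IsInverseRepresentation P A Γ Q T) : T = P.inverseRel A Γ := by
  set U := (LinRel.ofOp A).rho ∩ T.rho
  have hUo : IsOpen U := (LinRel.isOpen_rho _).inter (LinRel.isOpen_rho _)
  have hUc : ∀ z ∈ U, starRingEnd ℂ z ∈ U := fun z hz =>
    ⟨P.conj_mem_rho hQ.selfAdjoint hz.1, P.conj_mem_rho hT.selfAdjoint hz.2⟩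
  obtain ⟨z, hz⟩ := hT.nonempty
  -- Removing `z` permits cancelling `z - w`; removing `z̄` too keeps the set symmetric, so that it
  -- still meets both half planes.
  set F : Set ℂ := {z, starRingEnd ℂ z}
  have hFf : F.Finite := Set.toFinite _
  have hVo : IsOpen (U \ F) := hUo.sdiff hFf.isClosed
  have hVne : (U \ F).Nonempty := by
    obtain ⟨w, hw, hwF⟩ := (dense_univ.sdiff_finite hFf).inter_open_nonempty U hUo ⟨z, hz⟩
    exact ⟨w, hw, hwF.2⟩
  have hVc : ∀ w ∈ U \ F, starRingEnd ℂ w ∈ U \ F := by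
    rintro w ⟨hw, hwF⟩
    refine ⟨hUc w hw, fun h => hwF ?_⟩
    rcases h with h | h
    · right
      rw [Set.mem_singleton_iff, ← h, Complex.conj_conj]
    · left
      exact (starRingEnd ℂ).injective h
  obtain ⟨hp, hm⟩ := exists_im_pos_and_im_neg hVo hVne hVc
  have hdense := P.dense_span_gammaField hQ.form_apply hVo
    (fun w hw => hw.1.1) hp hm hQ.minimal
  have huz := hT.invertible z hz
  have hzρ := (hQ.mem_rho_inverseRel_iff hG hz.1).mpr huz
  have hres : T.res z = (P.inverseRel A Γ).res z := by
    refine ContinuousLinearMap.ext_on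
      (Submodule.dense_iff_topologicalClosure_eq_top.mpr hdense) ?_
    rintro _ ⟨w, hw, h, rfl⟩
    have huw := hT.invertible w hw.1
    have hzw : z - w ≠ 0 := sub_ne_zero.mpr fun e => hw.2 (Or.inl e.symm)
    rw [← invGammaField_neg huw]
    set v := invGammaField A Γ Q w (-Q w h) with hv
    have hfield : invGammaField A Γ Q z (-Q w h) = v + (z - w) • T.res z v := by
      rw [hT.field w hw.1 z hz]; rfl
    refine (smul_right_inj hzw).mp ?_
    rw [hv, hQ.smul_res_invGammaField hG hz.1 hw.1.1 huz huw, hfield, ← hv, add_sub_cancel_left]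
  exact LinRel.eq_of_isResolventAt (LinRel.isResolventAt_res hz.2)
    (hres ▸ LinRel.isResolventAt_res hzρ)

end IsMinimalOpRepresentation

/-! ### The intersection `S` and its defect space `𝓡 = ran Γ`. -/

namespace PontryaginStructure

theorem mem_inf_inverseRel (P : PontryaginStructure K κ) {A : K →L[ℂ] K} {Γ : H →L[ℂ] K}
    {p : K × K} : p ∈ LinRel.ofOp A ⊓ P.inverseRel A Γ ↔ p.2 = A p.1 ∧ P.opAdjoint Γ p.1 = 0 :=
  ⟨fun h => ⟨h.1, h.2.1⟩, fun h => ⟨h.1, h.2, 0, by rw [h.1, map_zero, add_zero]⟩⟩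

theorem mem_dom_inf_inverseRel (P : PontryaginStructure K κ) {A : K →L[ℂ] K} {Γ : H →L[ℂ] K}
    {f : K} : f ∈ (LinRel.ofOp A ⊓ P.inverseRel A Γ).dom ↔ P.opAdjoint Γ f = 0 := by
  constructor
  · rintro ⟨p, hp, rfl⟩
    exact (P.mem_inf_inverseRel.mp hp).2
  · intro hf
    exact ⟨(f, A f), P.mem_inf_inverseRel.mpr ⟨rfl, hf⟩, rfl⟩

theorem mem_orthCompanion_dom_inf (P : PontryaginStructure K κ) {A : K →L[ℂ] K}
    {Γ : H →L[ℂ] K} (hG : IsUnit (P.opAdjoint Γ ∘L Γ)) {x : K} :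
    x ∈ P.orthCompanion (LinRel.ofOp A ⊓ P.inverseRel A Γ).dom ↔ ∃ h, x = Γ h := by
  constructor
  · intro hx
    exact ⟨_, P.eq_gamma_of_orthogonal hG fun k hk =>
      hx k (P.mem_dom_inf_inverseRel.mpr hk)⟩
  · rintro ⟨h, rfl⟩ k hk
    rw [form_gamma_left, P.mem_dom_inf_inverseRel.mp hk, inner_zero_left]

theorem isClosed_ofOp_sup_defectInfinity (P : PontryaginStructure K κ) {A : K →L[ℂ] K}
    {Γ : H →L[ℂ] K} (hG : IsUnit (P.opAdjoint Γ ∘L Γ)) :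
    IsClosed ((LinRel.ofOp A ⊔ defectInfinity P (LinRel.ofOp A ⊓ P.inverseRel A Γ) :
      LinRel K) : Set (K × K)) := by
  have h : ((LinRel.ofOp A ⊔ defectInfinity P (LinRel.ofOp A ⊓ P.inverseRel A Γ) :
      LinRel K) : Set (K × K)) = {p : K × K | p.2 - A p.1 =
        Γ (Ring.inverse (P.opAdjoint Γ ∘L Γ) (P.opAdjoint Γ (p.2 - A p.1)))} := by
    ext ⟨f, g⟩
    rw [SetLike.mem_coe, Set.mem_ofPred_eq, ← P.exists_eq_gamma_iff hG,
      ← P.mem_orthCompanion_dom_inf (A := A) hG, Submodule.mem_sup]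
    constructor
    · rintro ⟨⟨f₁, g₁⟩, h₁, ⟨f₂, g₂⟩, ⟨h₂, h₂'⟩, h⟩
      obtain ⟨rfl, rfl⟩ := Prod.ext_iff.mp h
      obtain rfl : g₁ = A f₁ := h₁
      obtain rfl : f₂ = 0 := h₂
      simpa using h₂'
    · intro h
      exact ⟨(f, A f), rfl, (0, g - A f), ⟨rfl, h⟩, by simp⟩
  rw [h]
  exact isClosed_eq (by fun_prop) (by fun_prop)

theorem defectInfinity_le_inverseRel (P : PontryaginStructure K κ) {A : K →L[ℂ] K}
    {Γ : H →L[ℂ] K} (hG : IsUnit (P.opAdjoint Γ ∘L Γ)) :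
    defectInfinity P (LinRel.ofOp A ⊓ P.inverseRel A Γ) ≤ P.inverseRel A Γ := by
  rintro ⟨f, g⟩ ⟨hf, hg⟩
  obtain rfl : f = 0 := hf
  obtain ⟨h, rfl⟩ := (P.mem_orthCompanion_dom_inf hG).mp hg
  exact ⟨map_zero _, h, by simp⟩

theorem defectInfinity_le_relAdjoint (P : PontryaginStructure K κ) (S : LinRel K) :
    defectInfinity P S ≤ P.relAdjoint S := by
  rintro ⟨f, g⟩ ⟨hf, hg⟩ q hq
  obtain rfl : f = 0 := hf
  exact (P.form_zero_left _).trans (hg q.1 ⟨q, hq, rfl⟩).symm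

end PontryaginStructure

end

/-! ### The three regular extensions. -/

theorem corollary3p10
    {K : Type*} [NormedAddCommGroup K] [InnerProductSpace ℂ K] [CompleteSpace K]
    {H : Type*} [NormedAddCommGroup H] [InnerProductSpace ℂ H] [CompleteSpace H] [Nontrivial H]
    {κ : ℕ} (P : PontryaginStructure K κ)
    (A : K →L[ℂ] K) (Γ : H →L[ℂ] K) (Q : ℂ → H →L[ℂ] H)
    (hQ : IsMinimalOpRepresentation P A Γ Q)
    (D : H →L[ℂ] H) (hD : HasDerivAtInfinity Q D) (hDinv : IsUnit D) :
    (∃ Ahat : LinRel K, IsInverseRepresentation P A Γ Q Ahat) ∧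
    ∀ Ahat : LinRel K, IsInverseRepresentation P A Γ Q Ahat →
      ∀ S : LinRel K, S = LinRel.ofOp A ⊓ Ahat →
        IsRegularExtension P S (LinRel.ofOp A) ∧
        IsRegularExtension P S Ahat ∧
        IsRegularExtension P S (P.relAdjoint S) := by
  have hG := hQ.isUnit_gram hD hDinv
  have hsa := P.relAdjoint_inverseRel hQ.form_apply hG
  refine ⟨⟨_, hQ.isInverseRepresentation_inverseRel hG⟩, ?_⟩
  rintro Ahat hAhat S rfl
  obtain rfl := hQ.eq_inverseRel hG hAhat
  obtain ⟨u, hu⟩ := exists_ne (0 : H)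
  -- Strict because `Γ⁺` is onto `H ≠ 0`, so `ker Γ⁺ ≠ K`; for `Â` below, because `Γ` is injective
  -- and `(0, Γ u)` is not in the graph of `A`.
  have hltA : LinRel.ofOp A ⊓ P.inverseRel A Γ < LinRel.ofOp A := by
    refine lt_of_le_of_ne inf_le_left fun h => hu ?_
    obtain ⟨k, hk⟩ : ∃ k, P.opAdjoint Γ k = u := ⟨_, apply_ringInverse hG u⟩
    have hm : (k, A k) ∈ LinRel.ofOp A ⊓ P.inverseRel A Γ := by rw [h]; exact rfl
    exact hk.symm.trans (P.mem_inf_inverseRel.mp hm).2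
  have hlt : LinRel.ofOp A ⊓ P.inverseRel A Γ < P.inverseRel A Γ := by
    refine lt_of_le_of_ne inf_le_right fun h => hu (P.gamma_injective hG ?_)
    have hm : ((0 : K), Γ u) ∈ LinRel.ofOp A ⊓ P.inverseRel A Γ := by
      rw [h]; exact ⟨map_zero _, u, by simp⟩
    simpa using (P.mem_inf_inverseRel.mp hm).1
  have hA := P.relAdjoint_antitone (inf_le_left (a := LinRel.ofOp A) (b := P.inverseRel A Γ))
  have hAhat' := P.relAdjoint_antitone
    (inf_le_right (a := LinRel.ofOp A) (b := P.inverseRel A Γ))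
  rw [hQ.selfAdjoint] at hA
  rw [hsa] at hAhat'
  refine ⟨⟨⟨hltA, hA⟩, P.isClosed_ofOp_sup_defectInfinity hG⟩, ⟨⟨hlt, hAhat'⟩, ?_⟩,
    ⟨⟨hltA.trans_le hA, le_rfl⟩, ?_⟩⟩
  · rw [sup_eq_left.mpr (P.defectInfinity_le_inverseRel hG), ← hsa]
    exact P.isClosed_relAdjoint _
  · rw [sup_eq_left.mpr (P.defectInfinity_le_relAdjoint _)]
    exact P.isClosed_relAdjoint _
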